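/- **Spectral Theorem for representations.** Let $A$ be a commutative complex $*$-algebra (not necessarily unital or normed), let $H\neq\{0\}$ be a complex Hilbert space, and let $\pi$ be a non-degenerate representation of $A$ in $H$, i.e. an algebra homomorphism from $A$ into the linear operators on $H$ with $\langle\pi(a)x,y\rangle=\langle x,\pi(a^*)y\rangle$ for all $a\in A$, $x,y\in H$ (the operators $\pi(a)$ are then automatically bounded), such that $\pi(a)x=0$ for all $a\in A$ only if $x=0$. Let $B$ be the norm closure of $\pi(A)$ in $B(H)$, let $\Delta(B)$ be the set of non-zero multiplicative linear functionals on $B$, and put $$\mathrm{sp}(\pi):=\{\tau\circ\pi:\tau\in\Delta(B)\},$$ equipped with the weak* topology (pointwise convergence on $A$). Then $\mathrm{sp}(\pi)$ is contained in the set $\Delta^*(A)$ of non-zero multiplicative linear functionals $\sigma$ on $A$ with $\sigma(a^*)=\overline{\sigma(a)}$, it is a non-empty locally compact Hausdorff space, and there exists a unique resolution of identity $P$ on $\mathrm{sp}(\pi)$, acting on $H$, such that, with $\widehat a(\sigma):=\sigma(a)$, $$\pi(a)=\int_{\mathrm{sp}(\pi)}\widehat a\,dP\quad\text{(in norm)}\qquad\text{for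 all }a\in A.$$ Moreover, the commutants coincide, $\pi'=P'$ (that is, a bounded operator on $H$ commutes with all $\pi(a)$ if and only if it commutes with all $P(\omega)$), and the support of $P$ is all of $\mathrm{sp}(\pi)$. Here a *resolution of identity* on a non-empty locally compact Hausdorff space $\Omega$ is a map $P$ from the Borel sets of $\Omega$ to the orthogonal projections in $B(H)$ with $P(\Omega)=\mathbf 1$ such that for every $x\in H$ the function $\omega\mapsto\langle P(\omega)x,x\rangle$ is a measure that is inner regular with respect to compact sets. For a bounded Borel function $f$ on $\Omega$ and $T\in B(H)$, one writes $T=\int f\,dP$ (in norm) if $\|T-\sum_\alpha\alpha P(h=\alpha)\|\le\sup_{\Omega}|f-h|$ for every Borel step function $h$ on $\Omega$, the sum running over the finitely many values $\alpha$ of $h$. The *support* of $P$ is the complement of the largest open set $\omega$ with $P(\omega)=0$, if such a largest set exists. -/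

import Mathlib

open MeasureTheory

/-- A representation of a `*`-algebra `A` in a (pre-)Hilbert space `H`: an algebra homomorphism
into the algebra of all linear operators on `H` satisfying `⟨π(a)x, y⟩ = ⟨x, π(a*)y⟩`.
Boundedness of the operators is not part of the definition. -/
structure StarRep (A : Type*) (H : Type*) [NonUnitalRing A] [Module ℂ A] [Star A]
    [NormedAddCommGroup H] [InnerProductSpace ℂ H] where
  toHom : A →ₙₐ[ℂ] Module.End ℂ H
  inner_left' : ∀ (a : A) (x y : H), inner ℂ (toHom a x) y = inner ℂ x (toHom (star a) y)

namespace StarRep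

/-- On a Hilbert space the operators of a representation are automatically bounded. -/
theorem continuous_apply {A : Type*} {H : Type*} [NonUnitalRing A] [Module ℂ A] [Star A]
    [NormedAddCommGroup H] [InnerProductSpace ℂ H] [CompleteSpace H]
    (π : StarRep A H) (a : A) : Continuous (π.toHom a) := by
  refine (π.toHom a).continuous_of_seq_closed_graph fun u x y hu hTu ↦ ?_
  rw [← sub_eq_zero, ← @inner_self_eq_zero ℂ]
  have hlhs : ∀ k : ℕ, inner ℂ (π.toHom a (u k) - π.toHom a x) (y - π.toHom a x) =
      inner ℂ (u k - x) (π.toHom (star a) (y - π.toHom a x)) := by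
    intro k
    rw [← map_sub, π.inner_left']
  refine tendsto_nhds_unique ((hTu.sub_const _).inner tendsto_const_nhds) ?_
  simp_rw [Function.comp_apply, hlhs]
  rw [← inner_zero_left (𝕜 := ℂ) (π.toHom (star a) (y - π.toHom a x))]
  refine Filter.Tendsto.inner ?_ tendsto_const_nhds
  rw [← sub_self x]
  exact hu.sub_const _

variable {A : Type*} {H : Type*} [NonUnitalCommRing A] [Module ℂ A] [StarRing A]
  [NormedAddCommGroup H] [InnerProductSpace ℂ H] [CompleteSpace H]

/-- The representation viewed as a `*`-algebra homomorphism `A → B(H)`. -/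
noncomputable def toStarHom (π : StarRep A H) : A →⋆ₙₐ[ℂ] (H →L[ℂ] H) where
  toFun a := ⟨π.toHom a, π.continuous_apply a⟩
  map_smul' c a := by ext x; simp
  map_zero' := by ext x; simp
  map_add' a b := by ext x; simp
  map_mul' a b := by ext x; simp
  map_star' a := by
    rw [ContinuousLinearMap.star_eq_adjoint, ContinuousLinearMap.eq_adjoint_iff]
    intro x y
    simpa using π.inner_left' (star a) x y

/-- `π` is non-degenerate: the subspace of all `x` with `π(a)x = 0` for every `a` is `{0}`. -/
def NonDegenerate (π : StarRep A H) : Prop :=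
  ∀ x : H, (∀ a : A, π.toStarHom a x = 0) → x = 0

/-- The closure `B` of the range `R(π)` in `B(H)`, with respect to the operator norm. -/
noncomputable def closedRange (π : StarRep A H) : NonUnitalStarSubalgebra ℂ (H →L[ℂ] H) :=
  (NonUnitalStarAlgHom.range π.toStarHom).topologicalClosure

/-- `π` viewed as a homomorphism from `A` into the closure of its range. -/
noncomputable def toClosedRange (π : StarRep A H) : A →ₙₐ[ℂ] π.closedRange :=
  (NonUnitalStarAlgHom.codRestrict π.toStarHom π.closedRange
    fun a => subset_closure ⟨a, rfl⟩).toNonUnitalAlgHom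

end StarRep

/-- `Δ(A)`: the multiplicative linear functionals on `A`, that is, the non-zero linear functionals
`τ` with `τ(ab) = τ(a)τ(b)` (no continuity is required). -/
def multFunctionals (A : Type*) [NonUnitalRing A] [Module ℂ A] : Set (A →ₙₐ[ℂ] ℂ) :=
  {τ | τ ≠ 0}

/-- `Δ*(A)`: the Hermitian multiplicative linear functionals on the `*`-algebra `A`. -/
def hermitianMultFunctionals (A : Type*) [NonUnitalRing A] [Module ℂ A] [Star A] :
    Set (A →ₙₐ[ℂ] ℂ) :=
  {τ | τ ∈ multFunctionals A ∧ ∀ a : A, τ (star a) = star (τ a)}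

/-- The weak* topology: the coarsest topology making all evaluations `τ ↦ τ(a)` continuous. -/
noncomputable instance weakStarTopology {A : Type*} [NonUnitalRing A] [Module ℂ A] :
    TopologicalSpace (A →ₙₐ[ℂ] ℂ) :=
  TopologicalSpace.induced (fun τ (a : A) => τ a) inferInstance

noncomputable instance weakStarMeasurableSpace {A : Type*} [NonUnitalRing A] [Module ℂ A] :
    MeasurableSpace (A →ₙₐ[ℂ] ℂ) :=
  borel _

instance weakStarBorelSpace {A : Type*} [NonUnitalRing A] [Module ℂ A] :
    BorelSpace (A →ₙₐ[ℂ] ℂ) :=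
  ⟨rfl⟩

/-- `sp(π) = {τ ∘ π : τ ∈ Δ(B)}`, where `B` is the closure of the range of `π`. It carries the
weak* topology and its Borel σ-algebra. -/
noncomputable def StarRep.sp {A : Type*} {H : Type*} [NonUnitalCommRing A] [Module ℂ A] [StarRing A]
    [NormedAddCommGroup H] [InnerProductSpace ℂ H] [CompleteSpace H] (π : StarRep A H) :
    Set (A →ₙₐ[ℂ] ℂ) :=
  (fun τ : π.closedRange →ₙₐ[ℂ] ℂ => τ.comp π.toClosedRange) '' multFunctionals π.closedRange

/-- A spectral measure on the measurable space `Ω`, acting on `H`: a map from the σ-algebra of `Ω`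
to the projections in `H` with `P(Ω) = 1` and such that `ω ↦ ⟨P(ω)x, x⟩` is a measure for every
`x`. -/
structure SpectralMeasure (Ω : Type*) [MeasurableSpace Ω] (H : Type*)
    [NormedAddCommGroup H] [InnerProductSpace ℂ H] [CompleteSpace H] where
  toFun : {ω : Set Ω // MeasurableSet ω} → (H →L[ℂ] H)
  isStarProjection' : ∀ ω, IsStarProjection (toFun ω)
  map_univ' : toFun ⟨Set.univ, MeasurableSet.univ⟩ = 1
  exists_measure' : ∀ x : H, ∃ μ : Measure Ω, ∀ ω : {ω : Set Ω // MeasurableSet ω},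
    μ ω = ENNReal.ofReal (RCLike.re (inner ℂ (toFun ω x) x))

namespace SpectralMeasure

variable {Ω : Type*} [MeasurableSpace Ω] {H : Type*}
  [NormedAddCommGroup H] [InnerProductSpace ℂ H] [CompleteSpace H]

/-- The measure `⟨Px, x⟩`. -/
noncomputable def measure (P : SpectralMeasure Ω H) (x : H) : Measure Ω :=
  (P.exists_measure' x).choose

theorem measure_apply (P : SpectralMeasure Ω H) (x : H) {ω : Set Ω} (hω : MeasurableSet ω) :
    P.measure x ω = ENNReal.ofReal (RCLike.re (inner ℂ (P.toFun ⟨ω, hω⟩ x) x)) :=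
  (P.exists_measure' x).choose_spec ⟨ω, hω⟩

/-- `I_P(h) = ∑ α P(h = α)`, the integral of a step function `h`. -/
noncomputable def stepIntegral (P : SpectralMeasure Ω H) (h : SimpleFunc Ω ℂ) : H →L[ℂ] H :=
  ∑ α ∈ h.range, α • P.toFun ⟨h ⁻¹' {α}, h.measurableSet_fiber α⟩

/-- `T = ∫ f dP` in norm: `f` is a bounded measurable function, and `‖T - I_P(h)‖ ≤ |f - h|_∞` for
every step function `h`, where `|·|_∞` is the supremum norm. -/
def HasNormIntegral (P : SpectralMeasure Ω H) (f : Ω → ℂ) (T : H →L[ℂ] H) : Prop :=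
  Measurable f ∧ (∃ C : ℝ, ∀ s, ‖f s‖ ≤ C) ∧
    ∀ h : SimpleFunc Ω ℂ, ‖T - P.stepIntegral h‖ ≤ ⨆ s, ‖f s - h s‖

/-- `P` is a resolution of identity: `Ω` is a non-empty locally compact Hausdorff space with its
Borel σ-algebra, and each measure `⟨Px, x⟩` is inner regular with respect to compact sets. -/
def IsResolutionOfIdentity [TopologicalSpace Ω] [BorelSpace Ω] (P : SpectralMeasure Ω H) : Prop :=
  Nonempty Ω ∧ LocallyCompactSpace Ω ∧ T2Space Ω ∧ ∀ x : H, (P.measure x).InnerRegular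

/-- `S` is the support of `P`: its complement is the largest open set `ω` with `P(ω) = 0`. -/
def IsSupport [TopologicalSpace Ω] [BorelSpace Ω] (P : SpectralMeasure Ω H) (S : Set Ω) : Prop :=
  IsGreatest {ω : Set Ω | ∃ hω : IsOpen ω, P.toFun ⟨ω, hω.measurableSet⟩ = 0} Sᶜ

end SpectralMeasure

/-!
Let `X` be the character space of the unitization of `B`, so that the Gelfand transform identifies
that unitization with `C(X)` and the inclusion `B → B(H)` becomes a representation `φ` of `C(X)`.
For each `x`, the Riesz theorem represents `f ↦ ⟨x, φ(f)x⟩` by a regular measure `μ_x` on `X`, and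
`f ↦ φ(f)x` extends to an isometry `L²(μ_x) → H`. Applying it to a bounded Borel function `g` gives
`Φ(g)x`. Since `C(X)` is dense in `L²(μ)` for any finite sum `μ` of the `μ_x`, linearity in `x` and
multiplicativity in `g` pass from continuous to bounded Borel functions.

The non-zero functionals on `B` form an open subset of `X`, the complement of one point, and every
element of `B` has a Gelfand transform supported on it. Non-degeneracy therefore forces the spectral
projection of this open set to be `1`. Restriction of characters to `A` is continuous and injective
on the compact space `X`, as the image of `A` is dense in `B`, hence a homeomorphism onto its image,
which carries the open set onto `sp(π)`. There, `P(ω) = Φ(1_ω)`.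

A second resolution of identity has the same integrals of the functions `â`, hence of all `f ∈ C(X)`
by density, hence the same scalar measures by the Riesz theorem. If `P(U) = 0` for a non-empty open
`U`, then `φ` kills an Urysohn function supported in `U`, which is the transform of a non-zero
element of `B`: this is absurd.
-/

open scoped Topology CompactlySupported InnerProductSpace ComplexOrder

section BoundedMeasurable

variable {Ω : Type*} [MeasurableSpace Ω]

variable (Ω) in
/-- The `*`-algebra of bounded measurable complex functions on a measurable space. -/
def boundedMeasurable : StarSubalgebra ℂ (Ω → ℂ) where
  carrier := {g | Measurable g ∧ ∃ C : ℝ, ∀ s, ‖g s‖ ≤ C}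
  add_mem' := by
    rintro g h ⟨hg, C, hC⟩ ⟨hh, D, hD⟩
    exact ⟨hg.add hh, C + D, fun s => norm_add_le_of_le (hC s) (hD s)⟩
  mul_mem' := by
    rintro g h ⟨hg, C, hC⟩ ⟨hh, D, hD⟩
    exact ⟨hg.mul hh, C * D, fun s => norm_mul_le_of_le (hC s) (hD s)⟩
  algebraMap_mem' c := ⟨measurable_const, ‖c‖, fun _ => le_rfl⟩
  star_mem' := by
    rintro g ⟨hg, C, hC⟩
    exact ⟨Complex.continuous_conj.measurable.comp hg, C, fun s => by simpa using hC s⟩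

namespace boundedMeasurable

variable (g h : boundedMeasurable Ω)

/-- The indicator function of a measurable set, as a bounded measurable function. -/
noncomputable def indicator (ω : {ω : Set Ω // MeasurableSet ω}) : boundedMeasurable Ω :=
  ⟨ω.1.indicator 1, measurable_one.indicator ω.2, 1, fun s => by
    by_cases hs : s ∈ ω.1 <;> simp [hs]⟩

theorem isStarProjection_indicator (ω : {ω : Set Ω // MeasurableSet ω}) :
    IsStarProjection (indicator ω) := by
  constructor <;> ext s <;> by_cases hs : s ∈ ω.1 <;> simp [indicator, hs]

variable (Ω) in
theorem indicator_univ : indicator (⟨Set.univ, .univ⟩ : {ω : Set Ω // MeasurableSet ω}) = 1 := by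
  ext s
  simp [indicator]

variable (μ : Measure Ω) [IsFiniteMeasure μ]

theorem memLp : MemLp g.1 2 μ :=
  .of_bound g.2.1.aestronglyMeasurable _ (.of_forall g.2.2.choose_spec)

/-- The class of a bounded measurable function in `L²`. -/
noncomputable def toLp : boundedMeasurable Ω →ₗ[ℂ] Lp ℂ 2 μ where
  toFun g := (memLp g μ).toLp g.1
  map_add' g h := MemLp.toLp_add (memLp g μ) (memLp h μ)
  map_smul' c g := MemLp.toLp_const_smul c (memLp g μ)

theorem coeFn_toLp : toLp μ g =ᵐ[μ] g.1 := (memLp g μ).coeFn_toLp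

theorem inner_toLp : ⟪toLp μ g, toLp μ h⟫_ℂ = ∫ s, (star g * h).1 s ∂μ := by
  rw [L2.inner_def]
  refine integral_congr_ae ?_
  filter_upwards [coeFn_toLp g μ, coeFn_toLp h μ] with s hg hh
  simp [hg, hh, mul_comm]

theorem norm_toLp_mul_le {C : ℝ} (hC : ∀ s, ‖h.1 s‖ ≤ C) :
    ‖toLp μ (g * h)‖ ≤ C * ‖toLp μ g‖ := by
  refine Lp.norm_le_mul_norm_of_ae_le_mul ?_
  filter_upwards [coeFn_toLp g μ, coeFn_toLp (g * h) μ] with s hg hgh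
  rw [hg, hgh, mul_comm]
  exact norm_mul_le_of_le (hC s) le_rfl

theorem tendsto_toLp_mul {ι : Type*} {l : Filter ι} {u : ι → boundedMeasurable Ω}
    (hu : Filter.Tendsto (fun i => toLp μ (u i)) l (𝓝 (toLp μ g))) :
    Filter.Tendsto (fun i => toLp μ (u i * h)) l (𝓝 (toLp μ (g * h))) := by
  obtain ⟨C, hC⟩ := h.2.2
  rw [tendsto_iff_norm_sub_tendsto_zero] at hu ⊢
  refine squeeze_zero (fun _ => norm_nonneg _) (fun i => ?_) (by simpa using hu.const_mul C)
  simpa only [← map_sub, ← sub_mul] using norm_toLp_mul_le (u i - g) h μ hC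

/-- A simple function, as a bounded measurable function. -/
def ofSimpleFunc (h : SimpleFunc Ω ℂ) : boundedMeasurable Ω :=
  ⟨h, h.measurable, h.exists_forall_norm_le⟩

theorem ofSimpleFunc_eq_sum (h : SimpleFunc Ω ℂ) :
    ofSimpleFunc h = ∑ α ∈ h.range, α • indicator ⟨h ⁻¹' {α}, h.measurableSet_fiber α⟩ := by
  ext s
  simp only [AddSubmonoidClass.coe_finsetSum, Finset.sum_apply]
  rw [Finset.sum_eq_single (h s)]
  · simp [ofSimpleFunc, indicator]
  · intro α _ hα
    simp [indicator, hα.symm]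
  · simp

theorem exists_simpleFunc_norm_sub_le {ε : ℝ} (hε : 0 < ε) :
    ∃ h : SimpleFunc Ω ℂ, ∀ s, ‖g.1 s - h s‖ ≤ ε := by
  obtain ⟨hg, C, hC⟩ := g.2
  obtain ⟨t, ht⟩ := (isCompact_closedBall (0 : ℂ) C).elim_finite_subcover
    (fun n => Metric.ball (TopologicalSpace.denseSeq ℂ n) ε) (fun _ => Metric.isOpen_ball)
    (fun z _ => Set.mem_iUnion.2
      ((TopologicalSpace.denseRange_denseSeq ℂ).exists_dist_lt z hε))
  refine ⟨(SimpleFunc.nearestPt (TopologicalSpace.denseSeq ℂ) (t.sup id)).comp g.1 hg,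
    fun s => ?_⟩
  obtain ⟨n, hn, hs⟩ := Set.mem_iUnion₂.1 (ht (mem_closedBall_zero_iff.2 (hC s)))
  have hle := SimpleFunc.edist_nearestPt_le (TopologicalSpace.denseSeq ℂ) (g.1 s)
    (Finset.le_sup (f := id) hn)
  rw [edist_dist, edist_dist, ENNReal.ofReal_le_ofReal_iff dist_nonneg] at hle
  rw [← dist_eq_norm, dist_comm]
  exact hle.trans (Metric.mem_ball'.1 hs).le

variable {X : Type*} [TopologicalSpace X] [CompactSpace X] [MeasurableSpace X]
  [OpensMeasurableSpace X]

variable (X) in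
/-- The inclusion of the continuous functions on a compact space into the bounded measurable
functions. -/
noncomputable def ofContinuous : C(X, ℂ) →⋆ₐ[ℂ] boundedMeasurable X where
  toFun f := ⟨f, f.continuous.measurable, ‖f‖, f.norm_coe_le_norm⟩
  map_one' := rfl
  map_mul' _ _ := rfl
  map_zero' := rfl
  map_add' _ _ := rfl
  commutes' _ := rfl
  map_star' _ := rfl

theorem coe_ofContinuous (f : C(X, ℂ)) : (ofContinuous X f).1 = f :=
  rfl

theorem integral_ofContinuous_eq_inner (μ : Measure X) [IsFiniteMeasure μ] (f : C(X, ℂ)) :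
    ∫ s, f s ∂μ = ⟪toLp μ 1, toLp μ (ofContinuous X f)⟫_ℂ := by
  rw [inner_toLp, star_one, one_mul, coe_ofContinuous]

end boundedMeasurable

end BoundedMeasurable

namespace SpectralMeasure

variable {Ω : Type*} [MeasurableSpace Ω] {H : Type*}
  [NormedAddCommGroup H] [InnerProductSpace ℂ H] [CompleteSpace H] {P Q : SpectralMeasure Ω H}

theorem inner_toFun (P : SpectralMeasure Ω H) (ω : {ω : Set Ω // MeasurableSet ω}) (x : H) :
    ⟪x, P.toFun ω x⟫_ℂ = ((P.measure x).real ω : ℂ) := by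
  have hp := ContinuousLinearMap.IsPositive.of_isStarProjection (P.isStarProjection' ω)
  rw [measureReal_def, P.measure_apply x ω.2, ENNReal.toReal_ofReal (hp.re_inner_nonneg_left x),
    ← hp.inner_left_eq_inner_right]
  exact (hp.isSymmetric.coe_re_inner_apply_self x).symm

instance (P : SpectralMeasure Ω H) (x : H) : IsFiniteMeasure (P.measure x) :=
  ⟨by rw [P.measure_apply x .univ]; exact ENNReal.ofReal_lt_top⟩

theorem ext_of_measure (h : ∀ x, P.measure x = Q.measure x) : P = Q := by
  have : P.toFun = Q.toFun := by
    ext1 ω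
    rw [← ContinuousLinearMap.coe_inj, ← ext_inner_map]
    intro x
    rw [← inner_conj_symm, ContinuousLinearMap.coe_coe, ContinuousLinearMap.coe_coe,
      ← inner_conj_symm (Q.toFun ω x), inner_toFun, inner_toFun, h]
  cases P
  cases Q
  congr

theorem inner_stepIntegral (P : SpectralMeasure Ω H) (h : SimpleFunc Ω ℂ) (x : H) :
    ⟪x, P.stepIntegral h x⟫_ℂ = ∫ s, h s ∂P.measure x := by
  rw [← SimpleFunc.integral_eq_integral h (SimpleFunc.integrable_of_isFiniteMeasure h),
    SimpleFunc.integral_eq]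
  simp [stepIntegral, inner_toFun, mul_comm]

namespace HasNormIntegral

variable {f : Ω → ℂ} {T : H →L[ℂ] H}

theorem exists_seq_stepIntegral (hT : P.HasNormIntegral f T) :
    ∃ h : ℕ → SimpleFunc Ω ℂ, TendstoUniformly (fun n => h n) f Filter.atTop ∧
      Filter.Tendsto (fun n => P.stepIntegral (h n)) Filter.atTop (𝓝 T) := by
  have hpos : ∀ n : ℕ, (0 : ℝ) < 1 / (n + 1) := fun n => by positivity
  have hlim := tendsto_one_div_add_atTop_nhds_zero_nat (𝕜 := ℝ)
  choose h hh using fun n => boundedMeasurable.exists_simpleFunc_norm_sub_le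
    (⟨f, hT.1, hT.2.1⟩ : boundedMeasurable Ω) (hpos n)
  refine ⟨h, ?_, ?_⟩
  · refine Metric.tendstoUniformly_iff.2 fun ε hε => ?_
    filter_upwards [hlim.eventually_lt_const hε] with n hn s
    exact dist_eq_norm (f s) _ ▸ (hh n s).trans_lt hn
  · refine tendsto_iff_norm_sub_tendsto_zero.2 (squeeze_zero (fun _ => norm_nonneg _)
      (fun n => ?_) hlim)
    rw [norm_sub_rev]
    exact (hT.2.2 (h n)).trans (Real.iSup_le (hh n) (hpos n).le)

theorem mem_centralizer_centralizer (hT : P.HasNormIntegral f T) :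
    T ∈ Set.centralizer (Set.centralizer (Set.range P.toFun)) := by
  obtain ⟨h, -, hlim⟩ := hT.exists_seq_stepIntegral
  refine (Set.isClosed_centralizer _).mem_of_tendsto hlim (.of_forall fun n S hS => ?_)
  simp only [stepIntegral, Finset.mul_sum, Finset.sum_mul, mul_smul_comm, smul_mul_assoc]
  exact Finset.sum_congr rfl fun α _ => by rw [hS _ ⟨_, rfl⟩]

theorem inner_eq_integral (hT : P.HasNormIntegral f T) (x : H) :
    ⟪x, T x⟫_ℂ = ∫ s, f s ∂P.measure x := by
  obtain ⟨h, hf, hlim⟩ := hT.exists_seq_stepIntegral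
  have hinner : Filter.Tendsto (fun n => ⟪x, P.stepIntegral (h n) x⟫_ℂ) Filter.atTop
      (𝓝 ⟪x, T x⟫_ℂ) :=
    ((continuous_const.inner (continuous_eval_const x)).tendsto T).comp hlim
  refine tendsto_nhds_unique hinner ?_
  simp only [inner_stepIntegral]
  obtain ⟨C, hC⟩ := hT.2.1
  refine tendsto_integral_filter_of_norm_le_const
    (.of_forall fun n => (h n).aestronglyMeasurable) ⟨1 + C, ?_⟩
    (.of_forall fun s => hf.tendsto_at s)
  filter_upwards [Metric.tendstoUniformly_iff.1 hf 1 one_pos] with n hn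
  refine .of_forall fun s => ?_
  rw [← sub_add_cancel (h n s) (f s)]
  exact norm_add_le_of_le (by rw [← dist_eq_norm, dist_comm]; exact (hn s).le) (hC s)

end HasNormIntegral

section OfStarAlgHom

open boundedMeasurable

variable {Ψ : boundedMeasurable Ω →⋆ₐ[ℂ] (H →L[ℂ] H)} {ν : H → Measure Ω}
  [∀ x, IsFiniteMeasure (ν x)] (hΨ : ∀ g x, ⟪x, Ψ g x⟫_ℂ = ∫ s, g.1 s ∂ν x)

include hΨ

theorem measure_eq_ofReal_inner_indicator (ω : {ω : Set Ω // MeasurableSet ω}) (x : H) :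
    ν x ω = ENNReal.ofReal (RCLike.re ⟪Ψ (indicator ω) x, x⟫_ℂ) := by
  have hint : ∫ s, (indicator ω).1 s ∂ν x = ((ν x).real ω : ℂ) :=
    (integral_indicator_const (1 : ℂ) ω.2).trans (by simp)
  rw [← inner_conj_symm, hΨ, hint]
  simp

/-- The spectral measure `ω ↦ Ψ(1_ω)` of a `*`-homomorphism `Ψ` on the bounded measurable functions.
The identity `⟨x, Ψ(g)x⟩ = ∫ g dν_x` provides the countable additivity. -/
noncomputable def ofStarAlgHom : SpectralMeasure Ω H where
  toFun ω := Ψ (indicator ω)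
  isStarProjection' ω := (isStarProjection_indicator ω).map Ψ
  map_univ' := by rw [indicator_univ, map_one]
  exists_measure' x := ⟨ν x, fun ω => measure_eq_ofReal_inner_indicator hΨ ω x⟩

theorem measure_ofStarAlgHom (x : H) : (ofStarAlgHom hΨ).measure x = ν x := by
  ext ω hω
  rw [measure_apply _ _ hω]
  exact (measure_eq_ofReal_inner_indicator hΨ ⟨ω, hω⟩ x).symm

theorem stepIntegral_ofStarAlgHom (h : SimpleFunc Ω ℂ) :
    (ofStarAlgHom hΨ).stepIntegral h = Ψ (ofSimpleFunc h) := by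
  simp only [ofSimpleFunc_eq_sum, map_sum, map_smul]
  rfl

theorem norm_starAlgHom_apply_le {g : boundedMeasurable Ω} {C : ℝ} (hC : 0 ≤ C)
    (hg : ∀ s, ‖g.1 s‖ ≤ C) : ‖Ψ g‖ ≤ C := by
  refine ContinuousLinearMap.opNorm_le_bound _ hC fun x => le_of_sq_le_sq ?_ (by positivity)
  have hnorm : ‖Ψ g x‖ ^ 2 = ‖∫ s, (star g * g).1 s ∂ν x‖ := by
    rw [← hΨ, map_mul, map_star, ContinuousLinearMap.star_eq_adjoint, mul_apply_eq_comp,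
      ContinuousLinearMap.adjoint_inner_right, inner_self_eq_norm_sq_to_K]
    simp
  have hmass : (ν x).real Set.univ = ‖x‖ ^ 2 := by
    have := hΨ 1 x
    simp only [map_one, one_apply_eq_self, inner_self_eq_norm_sq_to_K, Complex.coe_algebraMap,
      OneMemClass.coe_one, Pi.one_apply, integral_const, Complex.real_smul, mul_one] at this
    exact_mod_cast this.symm
  calc ‖Ψ g x‖ ^ 2 ≤ C * C * (ν x).real Set.univ := by
        rw [hnorm]
        exact norm_integral_le_of_norm_le_const
          (.of_forall fun s => norm_mul_le_of_le (by simpa using hg s) (hg s))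
    _ = (C * ‖x‖) ^ 2 := by rw [hmass]; ring

theorem hasNormIntegral_ofStarAlgHom (g : boundedMeasurable Ω) :
    (ofStarAlgHom hΨ).HasNormIntegral g.1 (Ψ g) := by
  refine ⟨g.2.1, g.2.2, fun h => ?_⟩
  rw [stepIntegral_ofStarAlgHom, ← map_sub]
  obtain ⟨C, hC⟩ := (g - ofSimpleFunc h).2.2
  exact norm_starAlgHom_apply_le hΨ (Real.iSup_nonneg fun _ => norm_nonneg _)
    (le_ciSup ⟨C, Set.forall_mem_range.2 hC⟩)

end OfStarAlgHom

end SpectralMeasure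

section BorelCalculus

open boundedMeasurable

namespace boundedMeasurable

variable {Ω : Type*} [MeasurableSpace Ω]

theorem norm_toLp_mono (g : boundedMeasurable Ω) {μ ν : Measure Ω} [IsFiniteMeasure μ]
    [IsFiniteMeasure ν] (h : μ ≤ ν) : ‖toLp μ g‖ ≤ ‖toLp ν g‖ := by
  simp only [toLp, LinearMap.coe_mk, AddHom.coe_mk, Lp.norm_toLp]
  exact ENNReal.toReal_mono (memLp g ν).2.ne (eLpNorm_mono_measure _ h)

theorem exists_seq_tendsto_toLp_ofContinuous {X : Type*} [TopologicalSpace X] [CompactSpace X]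
    [T2Space X] [MeasurableSpace X] [BorelSpace X] {ι : Type*} (μ : ι → Measure X)
    [∀ i, IsFiniteMeasure (μ i)] [∀ i, (μ i).InnerRegular] (I : Finset ι)
    (g : boundedMeasurable X) :
    ∃ u : ℕ → C(X, ℂ), ∀ i ∈ I, Filter.Tendsto (fun n => toLp (μ i) (ofContinuous X (u n)))
      Filter.atTop (𝓝 (toLp (μ i) g)) := by
  set ν := ∑ i ∈ I, μ i
  obtain ⟨v, hv, hlim⟩ := mem_closure_iff_seq_limit.1
    (ContinuousMap.toLp_denseRange ℂ ν ℂ ENNReal.ofNat_ne_top (toLp ν g))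
  choose u hu using hv
  have hν : Filter.Tendsto (fun n => toLp ν (ofContinuous X (u n))) Filter.atTop
      (𝓝 (toLp ν g)) := hlim.congr fun n => (hu n).symm
  refine ⟨u, fun i hi => ?_⟩
  rw [tendsto_iff_norm_sub_tendsto_zero] at hν ⊢
  refine squeeze_zero (fun _ => norm_nonneg _) (fun n => ?_) hν
  rw [← map_sub, ← map_sub]
  exact norm_toLp_mono _ (Finset.single_le_sum (f := μ) (fun _ _ => Measure.zero_le _) hi)

end boundedMeasurable

theorem exists_linearIsometry_extension {𝕜 V E F : Type*} [NontriviallyNormedField 𝕜]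
    [AddCommGroup V] [Module 𝕜 V] [NormedAddCommGroup E] [NormedSpace 𝕜 E]
    [NormedAddCommGroup F] [NormedSpace 𝕜 F] [CompleteSpace F]
    (f : V →ₗ[𝕜] F) (e : V →ₗ[𝕜] E) (he : DenseRange e) (hf : ∀ v, ‖f v‖ = ‖e v‖) :
    ∃ U : E →ₗᵢ[𝕜] F, ∀ v, U (e v) = f v := by
  have hU : ∀ v, f.extendOfNorm e (e v) = f v :=
    LinearMap.extendOfNorm_eq he ⟨1, fun v => by rw [one_mul, hf]⟩
  have hnorm : ∀ y, ‖f.extendOfNorm e y‖ = ‖y‖ := fun y =>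
    he.induction_on y (isClosed_eq (by fun_prop) (by fun_prop)) fun v => by rw [hU, hf]
  exact ⟨⟨(f.extendOfNorm e).toLinearMap, hnorm⟩, hU⟩

variable {X : Type*} [TopologicalSpace X] [CompactSpace X] {H : Type*} [NormedAddCommGroup H]
  [InnerProductSpace ℂ H] [CompleteSpace H] (φ : C(X, ℂ) →⋆ₐ[ℂ] (H →L[ℂ] H))

/-- The positive functional `f ↦ ⟨x, φ(f)x⟩` on the real continuous functions on a compact space. -/
noncomputable def vectorFunctional (x : H) : C_c(X, ℝ) →ₚ[ℝ] ℝ :=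
  PositiveLinearMap.mk₀
    { toFun f := RCLike.re ⟪x, φ ((f : C(X, ℝ)).realToRCLike ℂ) x⟫_ℂ
      map_add' f g := by
        have h := map_add (ContinuousMap.realToRCLikeStarAlgHom X ℂ) (f : C(X, ℝ)) g
        exact (congrArg (fun k => RCLike.re ⟪x, φ k x⟫_ℂ) h).trans (by simp)
      map_smul' c f := by
        have h : ((c • f : C_c(X, ℝ)) : C(X, ℝ)).realToRCLike ℂ =
            (c : ℂ) • (f : C(X, ℝ)).realToRCLike ℂ := by ext; simp
        simp only [h, map_smul, smul_apply, inner_smul_right]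
        simp }
    fun f hf => by
      have h : 0 ≤ φ ((f : C(X, ℝ)).realToRCLike ℂ) :=
        map_nonneg φ fun s => Complex.zero_le_real.2 (hf s)
      exact ((ContinuousLinearMap.nonneg_iff_isPositive _).1 h).re_inner_nonneg_right x

variable [T2Space X] [MeasurableSpace X] [BorelSpace X]

/-- The regular Borel measure representing `f ↦ ⟨x, φ(f)x⟩`. -/
noncomputable def scalarMeasure (x : H) : Measure X :=
  RealRMK.rieszMeasure (vectorFunctional φ x)

instance (x : H) : (scalarMeasure φ x).Regular := RealRMK.regular_rieszMeasure _

theorem integral_scalarMeasure (x : H) (f : C(X, ℝ)) :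
    ∫ s, f s ∂scalarMeasure φ x = RCLike.re ⟪x, φ (f.realToRCLike ℂ) x⟫_ℂ :=
  RealRMK.integral_rieszMeasure (vectorFunctional φ x) ⟨f, HasCompactSupport.of_compactSpace _⟩

theorem norm_toLp_ofContinuous (x : H) (f : C(X, ℂ)) :
    ‖toLp (scalarMeasure φ x) (ofContinuous X f)‖ = ‖φ f x‖ := by
  have hre : ContinuousMap.realToRCLike ℂ ⟨fun s => ‖f s‖ ^ 2, by fun_prop⟩ = star f * f := by
    ext s
    simp [Complex.conj_mul']
  have hLp := inner_toLp (ofContinuous X f) (ofContinuous X f) (scalarMeasure φ x)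
  rw [inner_self_eq_norm_sq_to_K, ← map_star, ← map_mul, ← hre] at hLp
  have hint := integral_scalarMeasure φ x ⟨fun s => ‖f s‖ ^ 2, by fun_prop⟩
  rw [hre] at hint
  rw [map_mul, map_star, ContinuousLinearMap.star_eq_adjoint, mul_apply_eq_comp,
    ContinuousLinearMap.adjoint_inner_right, inner_self_eq_norm_sq] at hint
  refine (sq_eq_sq₀ (norm_nonneg _) (norm_nonneg _)).1 (Complex.ofReal_injective ?_)
  rw [← hint, ← integral_complex_ofReal, Complex.ofReal_pow]
  exact hLp

theorem exists_cyclicIsometry (x : H) : ∃ U : Lp ℂ 2 (scalarMeasure φ x) →ₗᵢ[ℂ] H,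
    ∀ f, U (toLp _ (ofContinuous X f)) = φ f x :=
  exists_linearIsometry_extension
    ((ContinuousLinearMap.apply ℂ H x).toLinearMap ∘ₗ φ.toAlgHom.toLinearMap)
    (ContinuousMap.toLp 2 (scalarMeasure φ x) ℂ).toLinearMap
    (ContinuousMap.toLp_denseRange ℂ _ ℂ ENNReal.ofNat_ne_top)
    fun f => (norm_toLp_ofContinuous φ x f).symm

/-- The isometry `L²(μ_x) → H` that extends `f ↦ φ(f)x`, where `μ_x` is the scalar measure of `x`.
Its range is the cyclic subspace generated by `x`. -/
noncomputable def cyclicIsometry (x : H) : Lp ℂ 2 (scalarMeasure φ x) →ₗᵢ[ℂ] H :=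
  (exists_cyclicIsometry φ x).choose

theorem cyclicIsometry_ofContinuous (x : H) (f : C(X, ℂ)) :
    cyclicIsometry φ x (toLp _ (ofContinuous X f)) = φ f x :=
  (exists_cyclicIsometry φ x).choose_spec f

theorem cyclicIsometry_one (x : H) : cyclicIsometry φ x (toLp _ 1) = x := by
  simpa using cyclicIsometry_ofContinuous φ x 1

theorem exists_seq_tendsto_cyclicIsometry (I : Finset H) (g : boundedMeasurable X) :
    ∃ u : ℕ → C(X, ℂ), ∀ x ∈ I,
      Filter.Tendsto (fun n => φ (u n) x) Filter.atTop (𝓝 (cyclicIsometry φ x (toLp _ g))) ∧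
      ∀ h, Filter.Tendsto (fun n => cyclicIsometry φ x (toLp _ (ofContinuous X (u n) * h)))
        Filter.atTop (𝓝 (cyclicIsometry φ x (toLp _ (g * h)))) := by
  obtain ⟨u, hu⟩ := exists_seq_tendsto_toLp_ofContinuous (scalarMeasure φ) I g
  refine ⟨u, fun x hx => ⟨?_, fun h => ?_⟩⟩
  · simpa only [Function.comp_def, cyclicIsometry_ofContinuous] using
      ((cyclicIsometry φ x).continuous.tendsto _).comp (hu x hx)
  · exact ((cyclicIsometry φ x).continuous.tendsto _).comp (tendsto_toLp_mul _ h _ (hu x hx))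

/-- The operator assigned to the bounded measurable function `g` by the Borel functional calculus
extending `φ`. -/
noncomputable def borelOperator (g : boundedMeasurable X) : H →L[ℂ] H :=
  LinearMap.mkContinuousOfExistsBound
    { toFun x := cyclicIsometry φ x (toLp _ g)
      map_add' x y := by
        classical
        obtain ⟨u, hu⟩ := exists_seq_tendsto_cyclicIsometry φ {x, y, x + y} g
        refine tendsto_nhds_unique (hu (x + y) (by simp)).1 ?_
        simpa only [map_add] using (hu x (by simp)).1.add (hu y (by simp)).1
      map_smul' c x := by
        classical
        obtain ⟨u, hu⟩ := exists_seq_tendsto_cyclicIsometry φ {x, c • x} g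
        refine tendsto_nhds_unique (hu (c • x) (by simp)).1 ?_
        simpa only [map_smul, RingHom.id_apply] using (hu x (by simp)).1.const_smul c }
    (by
      obtain ⟨C, hC⟩ := g.2.2
      refine ⟨C, fun x => ?_⟩
      have h := norm_toLp_mul_le 1 g (scalarMeasure φ x) hC
      rwa [one_mul, ← (cyclicIsometry φ x).norm_map, ← (cyclicIsometry φ x).norm_map (toLp _ 1),
        cyclicIsometry_one] at h)

theorem borelOperator_apply (g : boundedMeasurable X) (x : H) :
    borelOperator φ g x = cyclicIsometry φ x (toLp _ g) :=
  rfl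

theorem borelOperator_ofContinuous (f : C(X, ℂ)) : borelOperator φ (ofContinuous X f) = φ f :=
  ContinuousLinearMap.ext fun x => cyclicIsometry_ofContinuous φ x f

theorem inner_borelOperator (g : boundedMeasurable X) (x : H) :
    ⟪x, borelOperator φ g x⟫_ℂ = ∫ s, g.1 s ∂scalarMeasure φ x := by
  nth_rw 1 [borelOperator_apply, ← cyclicIsometry_one φ x]
  rw [LinearIsometry.inner_map_map, inner_toLp, star_one, one_mul]

theorem borelOperator_ofContinuous_mul (f : C(X, ℂ)) (h : boundedMeasurable X) :
    borelOperator φ (ofContinuous X f * h) = φ f * borelOperator φ h := by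
  ext x
  obtain ⟨v, hv⟩ := exists_seq_tendsto_cyclicIsometry φ {x} h
  obtain ⟨hv, hvf⟩ := hv x (by simp)
  refine tendsto_nhds_unique ?_ (((φ f).continuous.tendsto _).comp hv)
  refine Filter.Tendsto.congr (fun n => ?_) (mul_comm h _ ▸ hvf (ofContinuous X f))
  rw [← map_mul, cyclicIsometry_ofContinuous, mul_comm, map_mul]
  rfl

theorem borelOperator_mul (g h : boundedMeasurable X) :
    borelOperator φ (g * h) = borelOperator φ g * borelOperator φ h := by
  classical
  ext x
  obtain ⟨u, hu⟩ := exists_seq_tendsto_cyclicIsometry φ {x, borelOperator φ h x} g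
  refine tendsto_nhds_unique ((hu x (by simp)).2 h) ?_
  simpa only [← borelOperator_apply, borelOperator_ofContinuous_mul, mul_apply_eq_comp] using
    (hu (borelOperator φ h x) (by simp)).1

theorem borelOperator_star (g : boundedMeasurable X) :
    borelOperator φ (star g) = star (borelOperator φ g) := by
  rw [← ContinuousLinearMap.coe_inj, ← ext_inner_map]
  intro x
  rw [ContinuousLinearMap.coe_coe, ContinuousLinearMap.coe_coe,
    ContinuousLinearMap.star_eq_adjoint, ContinuousLinearMap.adjoint_inner_left,
    ← inner_conj_symm, inner_borelOperator, inner_borelOperator, ← integral_conj]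
  simp

/-- The Borel functional calculus: the extension of a representation `φ` of the continuous functions
on a compact Hausdorff space to the bounded Borel functions. -/
noncomputable def borelCalculus : boundedMeasurable X →⋆ₐ[ℂ] (H →L[ℂ] H) where
  toFun := borelOperator φ
  map_one' := by simpa using borelOperator_ofContinuous φ 1
  map_mul' := borelOperator_mul φ
  map_zero' := by simpa using borelOperator_ofContinuous φ 0
  map_add' g h := by ext x; simp [borelOperator_apply]
  commutes' c := by
    simpa [AlgHomClass.commutes] using borelOperator_ofContinuous φ (algebraMap ℂ _ c)
  map_star' := borelOperator_star φ

theorem borelCalculus_ofContinuous (f : C(X, ℂ)) : borelCalculus φ (ofContinuous X f) = φ f :=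
  borelOperator_ofContinuous φ f

theorem inner_borelCalculus (g : boundedMeasurable X) (x : H) :
    ⟪x, borelCalculus φ g x⟫_ℂ = ∫ s, g.1 s ∂scalarMeasure φ x :=
  inner_borelOperator φ g x

theorem borelCalculus_mem_centralizer_centralizer (g : boundedMeasurable X) :
    borelCalculus φ g ∈ Set.centralizer (Set.centralizer (Set.range φ)) := by
  classical
  intro S hS
  ext x
  obtain ⟨u, hu⟩ := exists_seq_tendsto_cyclicIsometry φ {x, S x} g
  refine tendsto_nhds_unique ((S.continuous.tendsto _).comp (hu x (by simp)).1) ?_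
  refine (hu (S x) (by simp)).1.congr fun n => ?_
  exact congrArg (· x) (hS (φ (u n)) ⟨_, rfl⟩)

end BorelCalculus

section OpenEmbedding

open boundedMeasurable

namespace boundedMeasurable

variable {Ω X : Type*} [MeasurableSpace Ω] [MeasurableSpace X] {e : Ω → X}

/-- Extension by zero of the bounded measurable functions along a measurable embedding. -/
noncomputable def extendByZero (he : MeasurableEmbedding e) :
    boundedMeasurable Ω →⋆ₙₐ[ℂ] boundedMeasurable X where
  toFun g := ⟨Function.extend e g.1 0, he.measurable_extend g.2.1 measurable_zero, by
    obtain ⟨C, hC⟩ := g.2.2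
    refine ⟨max C 0, fun t => ?_⟩
    by_cases ht : t ∈ Set.range e
    · obtain ⟨s, rfl⟩ := ht
      simp [he.injective.extend_apply, hC s]
    · simp [Function.extend_apply' _ _ _ ht]⟩
  map_smul' c g := Subtype.ext (by simpa using Function.extend_smul c e g.1 0)
  map_zero' := Subtype.ext (Function.extend_zero e)
  map_add' g h := Subtype.ext (by simpa using Function.extend_add e g.1 h.1 0 0)
  map_mul' g h := Subtype.ext (by simpa using Function.extend_mul e g.1 h.1 0 0)
  map_star' g := Subtype.ext (funext fun t => by
    simpa [Function.comp_def] using! (Function.apply_extend star (g := g.1) e 0 t).symm)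

variable (he : MeasurableEmbedding e)

theorem extendByZero_apply (g : boundedMeasurable Ω) (s : Ω) :
    (extendByZero he g).1 (e s) = g.1 s :=
  he.injective.extend_apply _ _ _

theorem extendByZero_of_notMem_range (g : boundedMeasurable Ω) {t : X} (ht : t ∉ Set.range e) :
    (extendByZero he g).1 t = 0 :=
  Function.extend_apply' _ _ _ ht

theorem extendByZero_eq_mul_indicator {g : boundedMeasurable Ω} {h : boundedMeasurable X}
    (hgh : g.1 = h.1 ∘ e) :
    extendByZero he g = h * indicator ⟨Set.range e, he.measurableSet_range⟩ := by
  ext t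
  by_cases ht : t ∈ Set.range e
  · obtain ⟨s, rfl⟩ := ht
    simp [extendByZero_apply, hgh, indicator]
  · simp [extendByZero_of_notMem_range he g ht, indicator, ht]

theorem integral_extendByZero (g : boundedMeasurable Ω) (μ : Measure X) :
    ∫ t, (extendByZero he g).1 t ∂μ = ∫ s, g.1 s ∂μ.comap e := by
  rw [← setIntegral_eq_integral_of_forall_compl_eq_zero (s := Set.range e)
    fun t ht => extendByZero_of_notMem_range he g ht, ← he.map_comap, he.integral_map]
  simp only [extendByZero_apply]

end boundedMeasurable

variable {X : Type*} [TopologicalSpace X] [CompactSpace X] [T2Space X] [MeasurableSpace X]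
  [BorelSpace X] {H : Type*} [NormedAddCommGroup H] [InnerProductSpace ℂ H] [CompleteSpace H]
  {φ : C(X, ℂ) →⋆ₐ[ℂ] (H →L[ℂ] H)}

theorem borelCalculus_indicator_eq_one {E : Set X} (hE : MeasurableSet E)
    (h : ∀ x, (∀ f : C(X, ℂ), (∀ t ∉ E, f t = 0) → φ f x = 0) → x = 0) :
    borelCalculus φ (indicator ⟨E, hE⟩) = 1 := by
  ext x
  refine sub_eq_zero.1 (h _ fun f hf => ?_)
  have hfE : ofContinuous X f * indicator ⟨E, hE⟩ = ofContinuous X f := by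
    ext t
    by_cases ht : t ∈ E
    · simp [indicator, ht]
    · simp [indicator, coe_ofContinuous, hf t ht, ht]
  rw [map_sub, ← mul_apply_eq_comp, ← borelCalculus_ofContinuous, ← map_mul, hfE,
    one_apply_eq_self, sub_self]

section MeasurableEmbedding

variable {Ω : Type*} [MeasurableSpace Ω] {e : Ω → X} (he : MeasurableEmbedding e)
  (hrange : borelCalculus φ (indicator ⟨Set.range e, he.measurableSet_range⟩) = 1)

include hrange

theorem borelCalculus_extendByZero_of_eq_comp {g : boundedMeasurable Ω} {h : boundedMeasurable X}
    (hgh : g.1 = h.1 ∘ e) : borelCalculus φ (extendByZero he g) = borelCalculus φ h := by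
  rw [extendByZero_eq_mul_indicator he hgh, map_mul, hrange, mul_one]

/-- The Borel functional calculus of `φ` on a subspace `e : Ω → X` whose spectral projection
is `1`. -/
noncomputable def borelCalculusOn : boundedMeasurable Ω →⋆ₐ[ℂ] (H →L[ℂ] H) where
  toFun g := borelCalculus φ (extendByZero he g)
  map_one' := by
    rw [borelCalculus_extendByZero_of_eq_comp (h := 1) he hrange rfl, map_one]
  map_mul' g h := by rw [map_mul, map_mul]
  map_zero' := by rw [map_zero, map_zero]
  map_add' g h := by rw [map_add, map_add]
  commutes' c := by
    rw [borelCalculus_extendByZero_of_eq_comp (h := algebraMap ℂ _ c) he hrange rfl,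
      AlgHomClass.commutes]
  map_star' g := by rw [map_star, map_star]

theorem inner_borelCalculusOn (g : boundedMeasurable Ω) (x : H) :
    ⟪x, borelCalculusOn he hrange g x⟫_ℂ = ∫ s, g.1 s ∂(scalarMeasure φ x).comap e :=
  (inner_borelCalculus φ _ x).trans (integral_extendByZero he g _)

/-- The spectral measure of `φ` on a subspace `e : Ω → X` whose spectral projection is `1`. -/
noncomputable def spectralMeasureOn : SpectralMeasure Ω H :=
  .ofStarAlgHom (inner_borelCalculusOn he hrange)

theorem spectralMeasureOn_toFun (ω : {ω : Set Ω // MeasurableSet ω}) :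
    (spectralMeasureOn he hrange).toFun ω = borelCalculus φ (extendByZero he (indicator ω)) :=
  rfl

theorem measure_spectralMeasureOn (x : H) :
    (spectralMeasureOn he hrange).measure x = (scalarMeasure φ x).comap e :=
  SpectralMeasure.measure_ofStarAlgHom _ x

theorem hasNormIntegral_spectralMeasureOn (f : C(X, ℂ)) :
    (spectralMeasureOn he hrange).HasNormIntegral (f ∘ e) (φ f) := by
  let g : boundedMeasurable Ω :=
    ⟨f ∘ e, f.continuous.measurable.comp he.measurable, ‖f‖, fun s => f.norm_coe_le_norm _⟩
  have hg : borelCalculusOn he hrange g = φ f :=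
    (borelCalculus_extendByZero_of_eq_comp he hrange (h := ofContinuous X f) rfl).trans
      (borelCalculus_ofContinuous φ f)
  exact hg ▸ SpectralMeasure.hasNormIntegral_ofStarAlgHom (inner_borelCalculusOn he hrange) g

theorem centralizer_range_spectralMeasureOn :
    Set.centralizer (Set.range (spectralMeasureOn he hrange).toFun) =
      Set.centralizer (Set.range φ) := by
  refine Set.Subset.antisymm (fun S hS => ?_) fun S hS => ?_
  · rintro _ ⟨f, rfl⟩
    exact ((hasNormIntegral_spectralMeasureOn he hrange f).mem_centralizer_centralizer S hS).symm
  · rintro _ ⟨ω, rfl⟩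
    exact (borelCalculus_mem_centralizer_centralizer φ _ S hS).symm

theorem nonempty_of_borelCalculus_indicator_range_eq_one [Nontrivial H] : Nonempty Ω := by
  by_contra hΩ
  rw [not_nonempty_iff] at hΩ
  have h0 : (1 : boundedMeasurable Ω) = 0 := Subtype.ext (Subsingleton.elim _ _)
  exact one_ne_zero ((map_one (borelCalculusOn he hrange)).symm.trans (by rw [h0, map_zero]))

end MeasurableEmbedding

section IsOpenEmbedding

variable {Ω : Type*} [TopologicalSpace Ω] [MeasurableSpace Ω] [BorelSpace Ω] {e : Ω → X}
  (he : Topology.IsOpenEmbedding e)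
  (hrange : borelCalculus φ (indicator ⟨Set.range e, he.measurableEmbedding.measurableSet_range⟩)
    = 1)

include hrange

theorem isResolutionOfIdentity_spectralMeasureOn [Nontrivial H] :
    (spectralMeasureOn he.measurableEmbedding hrange).IsResolutionOfIdentity := by
  refine ⟨nonempty_of_borelCalculus_indicator_range_eq_one he.measurableEmbedding hrange,
    he.locallyCompactSpace, he.isEmbedding.t2Space, fun x => ?_⟩
  rw [measure_spectralMeasureOn]
  exact Measure.InnerRegular.comap' _ he

theorem eq_spectralMeasureOn {Q : SpectralMeasure Ω H} (hQ : ∀ x, (Q.measure x).InnerRegular)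
    (h : ∀ (f : C(X, ℂ)) (x : H), ∫ s, f (e s) ∂Q.measure x = ⟪x, φ f x⟫_ℂ) :
    Q = spectralMeasureOn he.measurableEmbedding hrange := by
  refine SpectralMeasure.ext_of_measure fun x => ?_
  have := hQ x
  have : ((Q.measure x).map e).InnerRegular :=
    Measure.InnerRegular.map_of_continuous he.continuous
  have hmap : (Q.measure x).map e = scalarMeasure φ x := by
    refine Measure.ext_of_integral_eq_on_compactlySupported fun f => ?_
    refine Eq.trans ?_ (integral_scalarMeasure φ x (f : C(X, ℝ))).symm
    rw [he.measurableEmbedding.integral_map, ← h]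
    exact (congrArg RCLike.re (integral_ofReal (𝕜 := ℂ))).symm
  rw [measure_spectralMeasureOn, ← hmap, he.measurableEmbedding.comap_map]

theorem eq_zero_of_spectralMeasureOn_eq_zero {U : {ω : Set Ω // MeasurableSet ω}}
    (hU : (spectralMeasureOn he.measurableEmbedding hrange).toFun U = 0) {f : C(X, ℂ)}
    (hf : ∀ t ∉ e '' U, f t = 0) : φ f = 0 := by
  have hfU : ofContinuous X f * extendByZero he.measurableEmbedding (indicator U) =
      ofContinuous X f := by
    ext t
    by_cases ht : t ∈ e '' U
    · obtain ⟨s, hs, rfl⟩ := ht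
      simp [extendByZero_apply, indicator, hs]
    · simp [coe_ofContinuous, hf t ht]
  rw [← borelCalculus_ofContinuous, ← hfU, map_mul, ← spectralMeasureOn_toFun _ hrange, hU,
    mul_zero]

theorem isSupport_spectralMeasureOn
    (hφ : ∀ f : C(X, ℂ), (∀ t ∉ Set.range e, f t = 0) → φ f = 0 → f = 0) :
    (spectralMeasureOn he.measurableEmbedding hrange).IsSupport Set.univ := by
  have hempty : indicator (⟨Set.univᶜ, by simp⟩ : {ω : Set Ω // MeasurableSet ω}) = 0 := by
    ext s
    simp [indicator]
  refine ⟨⟨by simp, by rw [spectralMeasureOn_toFun, hempty, map_zero, map_zero]⟩, ?_⟩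
  rintro U ⟨hU, hPU⟩ s hs
  obtain ⟨f, hf0, hf1, -⟩ := exists_continuous_zero_one_of_isClosed
    (he.isOpenMap U hU).isClosed_compl (isClosed_singleton (x := e s))
    (Set.disjoint_singleton_right.2 fun h => h ⟨s, hs, rfl⟩)
  have hf : ∀ t ∉ e '' U, f.realToRCLike ℂ t = 0 := fun t ht => by simpa using hf0 ht
  have hzero : f.realToRCLike ℂ = 0 :=
    hφ _ (fun t ht => hf t fun ht' => ht (Set.image_subset_range _ _ ht'))
      (eq_zero_of_spectralMeasureOn_eq_zero he hrange hPU hf)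
  simpa [hf1 rfl] using DFunLike.congr_fun hzero (e s)

end IsOpenEmbedding

end OpenEmbedding

section Characters

variable {B : Type*} [NonUnitalCommCStarAlgebra B]

variable (B) in
/-- The character space of the unitization of `B`: the one-point compactification of the space of
characters of `B`, the zero functional being the point at infinity. -/
abbrev UnitizedSpectrum : Type _ := WeakDual.characterSpace ℂ (Unitization ℂ B)

namespace UnitizedSpectrum

noncomputable instance : MeasurableSpace (UnitizedSpectrum B) := borel _

instance : BorelSpace (UnitizedSpectrum B) := ⟨rfl⟩

/-- The restriction of the characters of the unitization to `B`: a bijection onto the multiplicative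
functionals, including the zero functional. -/
noncomputable def restrict : UnitizedSpectrum B ≃ (B →ₙₐ[ℂ] ℂ) :=
  WeakDual.CharacterSpace.equivAlgHom.trans Unitization.lift.symm

theorem restrict_apply (χ : UnitizedSpectrum B) (b : B) : restrict χ b = χ (b : Unitization ℂ B) :=
  rfl

theorem restrict_star (χ : UnitizedSpectrum B) (b : B) :
    restrict χ (star b) = star (restrict χ b) := by
  rw [restrict_apply, Unitization.inr_star, map_star, restrict_apply]

theorem continuous_restrict_apply (b : B) : Continuous fun χ : UnitizedSpectrum B => restrict χ b :=
  (WeakDual.eval_continuous _).comp continuous_subtype_val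

theorem continuous_restrict (χ : UnitizedSpectrum B) : Continuous (restrict χ) :=
  (map_continuous χ).comp Unitization.isometry_inr.continuous

theorem isOpen_setOf_restrict_ne_zero : IsOpen {χ : UnitizedSpectrum B | restrict χ ≠ 0} := by
  simp only [ne_eq, NonUnitalAlgHom.ext_iff, not_forall, Set.ofPred_exists]
  exact isOpen_iUnion fun b => isOpen_ne_fun (continuous_restrict_apply b) continuous_const

end UnitizedSpectrum

theorem isEmbedding_coe_nonUnitalAlgHom {A : Type*} [NonUnitalRing A] [Module ℂ A] :
    Topology.IsEmbedding ((⇑) : (A →ₙₐ[ℂ] ℂ) → A → ℂ) :=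
  ⟨⟨rfl⟩, DFunLike.coe_injective⟩

instance {A : Type*} [NonUnitalRing A] [Module ℂ A] : T2Space (A →ₙₐ[ℂ] ℂ) :=
  isEmbedding_coe_nonUnitalAlgHom.t2Space

open UnitizedSpectrum

variable {A : Type*} [NonUnitalRing A] [Module ℂ A] (ι : A →ₙₐ[ℂ] B)

/-- The functionals `τ ∘ ι` on `A`, where `τ` ranges over the characters of `B`. -/
def spectrumVia : Set (A →ₙₐ[ℂ] ℂ) :=
  (fun τ : B →ₙₐ[ℂ] ℂ => τ.comp ι) '' multFunctionals B

theorem spectrumVia_eq_image :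
    spectrumVia ι = (fun χ => (restrict χ).comp ι) '' {χ | restrict χ ≠ 0} := by
  refine Set.Subset.antisymm ?_ ?_
  · rintro _ ⟨τ, hτ, rfl⟩
    exact ⟨restrict.symm τ, by simpa using! hτ, by simp⟩
  · rintro _ ⟨χ, hχ, rfl⟩
    exact ⟨restrict χ, hχ, rfl⟩

variable {ι} (hι : DenseRange ι)

include hι

theorem eq_of_restrict_comp_eq {χ χ' : UnitizedSpectrum B}
    (h : (restrict χ).comp ι = (restrict χ').comp ι) : χ = χ' :=
  restrict.injective <| DFunLike.coe_injective <|
    hι.equalizer (continuous_restrict χ) (continuous_restrict χ') (congrArg (⇑) h)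

theorem isEmbedding_restrict_comp :
    Topology.IsEmbedding fun χ : UnitizedSpectrum B => (restrict χ).comp ι := by
  refine (Continuous.isClosedEmbedding ?_ fun _ _ h => eq_of_restrict_comp_eq hι h).isEmbedding
  exact continuous_induced_rng.2 (continuous_pi fun a => continuous_restrict_apply (ι a))

theorem spectrumVia_subset_hermitianMultFunctionals [Star A]
    (hstar : ∀ a, ι (star a) = star (ι a)) : spectrumVia ι ⊆ hermitianMultFunctionals A := by
  rw [spectrumVia_eq_image]
  rintro _ ⟨χ, hχ, rfl⟩
  refine ⟨fun h => hχ ?_, fun a => ?_⟩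
  · exact DFunLike.coe_injective <|
      hι.equalizer (continuous_restrict χ) continuous_const (congrArg (⇑) h)
  · exact (congrArg (restrict χ) (hstar a)).trans (restrict_star χ (ι a))

/-- The homeomorphism `χ ↦ χ ∘ ι` from the non-zero characters onto `spectrumVia ι`. -/
noncomputable def spectrumViaHomeomorph :
    {χ : UnitizedSpectrum B | restrict χ ≠ 0} ≃ₜ spectrumVia ι :=
  ((isEmbedding_restrict_comp hι).homeomorphImage _).trans
    (.setCongr (spectrumVia_eq_image ι).symm)

/-- The unital extension of a functional in `spectrumVia ι` to a character of the unitization. -/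
noncomputable def unitalExtension (σ : spectrumVia ι) : UnitizedSpectrum B :=
  (spectrumViaHomeomorph hι).symm σ

theorem restrict_unitalExtension (σ : spectrumVia ι) (a : A) :
    restrict (unitalExtension hι σ) (ι a) = (σ : A →ₙₐ[ℂ] ℂ) a :=
  DFunLike.congr_fun (congrArg Subtype.val ((spectrumViaHomeomorph hι).apply_symm_apply σ)) a

theorem range_unitalExtension :
    Set.range (unitalExtension hι) = {χ : UnitizedSpectrum B | restrict χ ≠ 0} :=
  ((spectrumViaHomeomorph hι).symm.surjective.range_comp Subtype.val).trans Subtype.range_val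

theorem isOpenEmbedding_unitalExtension : Topology.IsOpenEmbedding (unitalExtension hι) :=
  isOpen_setOf_restrict_ne_zero.isOpenEmbedding_subtypeVal.comp
    (spectrumViaHomeomorph hι).symm.isOpenEmbedding

end Characters

section Representation

open UnitizedSpectrum boundedMeasurable
open scoped CStarAlgebra

variable {B : Type*} [NonUnitalCommCStarAlgebra B] {H : Type*} [NormedAddCommGroup H]
  [InnerProductSpace ℂ H] [CompleteSpace H] {ρ : B →⋆ₙₐ[ℂ] (H →L[ℂ] H)}

variable (B) in
/-- The Gelfand transform of a non-unital `C*`-algebra, as continuous functions on the character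
space of its unitization. -/
noncomputable def gelfandInr : B →⋆ₙₐ[ℂ] C(UnitizedSpectrum B, ℂ) :=
  (gelfandStarTransform (Unitization ℂ B) : Unitization ℂ B →⋆ₙₐ[ℂ] _).comp
    (Unitization.inrNonUnitalStarAlgHom ℂ B)

theorem gelfandInr_apply (b : B) (χ : UnitizedSpectrum B) : gelfandInr B b χ = restrict χ b :=
  rfl

theorem continuous_gelfandInr : Continuous (gelfandInr B) :=
  (gelfandTransform_isometry (Unitization ℂ B)).continuous.comp Unitization.isometry_inr.continuous

theorem exists_eq_algebraMap_add_gelfandInr (f : C(UnitizedSpectrum B, ℂ)) :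
    ∃ (r : ℂ) (b : B), f = algebraMap ℂ _ r + gelfandInr B b := by
  obtain ⟨u, rfl⟩ := (gelfandStarTransform (Unitization ℂ B)).surjective f
  induction u with
  | inl_add_inr r b =>
    refine ⟨r, b, ?_⟩
    rw [map_add]
    exact congrArg (· + _) (AlgHomClass.commutes (gelfandStarTransform (Unitization ℂ B)) r)

variable (ρ) in
/-- The continuous functional calculus of a representation of `B` on the character space of the
unitization. -/
noncomputable def continuousCalculus : C(UnitizedSpectrum B, ℂ) →⋆ₐ[ℂ] (H →L[ℂ] H) :=
  (Unitization.starLift ρ).comp (gelfandStarTransform (Unitization ℂ B)).symm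

theorem continuousCalculus_gelfandInr (b : B) : continuousCalculus ρ (gelfandInr B b) = ρ b := by
  refine (congrArg (Unitization.starLift ρ)
    ((gelfandStarTransform (Unitization ℂ B)).symm_apply_apply b)).trans ?_
  exact DFunLike.congr_fun (Unitization.starLift.symm_apply_apply ρ) b

theorem eq_zero_of_continuousCalculus_eq_zero (hρ : Function.Injective ρ)
    {f : C(UnitizedSpectrum B, ℂ)} (hf : f (restrict.symm 0) = 0)
    (h0 : continuousCalculus ρ f = 0) : f = 0 := by
  obtain ⟨r, b, rfl⟩ := exists_eq_algebraMap_add_gelfandInr f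
  obtain rfl : r = 0 := by simpa [gelfandInr_apply] using hf
  rw [map_zero, zero_add] at h0 ⊢
  rw [continuousCalculus_gelfandInr] at h0
  rw [(map_eq_zero_iff ρ hρ).1 h0, map_zero]

variable {A : Type*} [NonUnitalRing A] [Module ℂ A] {ι : A →ₙₐ[ℂ] B} (hι : DenseRange ι)

include hι

theorem centralizer_range_continuousCalculus :
    Set.centralizer (Set.range (continuousCalculus ρ)) =
      Set.centralizer (Set.range fun a => ρ (ι a)) := by
  refine Set.Subset.antisymm (Set.centralizer_subset ?_) fun S hS => ?_
  · rintro _ ⟨a, rfl⟩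
    exact ⟨_, continuousCalculus_gelfandInr (ι a)⟩
  · have hcont := map_continuous ρ
    have hB : ∀ b, ρ b * S = S * ρ b := congrFun <|
      hι.equalizer (hcont.mul continuous_const) (continuous_const.mul hcont)
        (funext fun a => hS _ ⟨a, rfl⟩)
    rintro _ ⟨f, rfl⟩
    obtain ⟨r, b, rfl⟩ := exists_eq_algebraMap_add_gelfandInr f
    simp only [map_add, AlgHomClass.commutes, continuousCalculus_gelfandInr, add_mul, mul_add,
      hB, Algebra.commutes]

theorem borelCalculus_indicator_range_unitalExtension (hρ : ∀ x, (∀ b, ρ b x = 0) → x = 0) :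
    borelCalculus (continuousCalculus ρ) (indicator ⟨Set.range (unitalExtension hι),
      (isOpenEmbedding_unitalExtension hι).measurableEmbedding.measurableSet_range⟩) = 1 := by
  refine borelCalculus_indicator_eq_one _ fun x hx => hρ x fun b => ?_
  rw [← continuousCalculus_gelfandInr]
  refine hx _ fun χ hχ => ?_
  rw [range_unitalExtension, Set.mem_ofPred_eq, not_not] at hχ
  rw [gelfandInr_apply, hχ, NonUnitalAlgHom.zero_apply]

theorem integral_eq_inner_continuousCalculus {μ : Measure (UnitizedSpectrum B)}
    [IsFiniteMeasure μ] {x : H} (hμ : (μ.real Set.univ : ℂ) = ⟪x, x⟫_ℂ)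
    (hA : ∀ a, ∫ χ, restrict χ (ι a) ∂μ = ⟪x, ρ (ι a) x⟫_ℂ) (f : C(UnitizedSpectrum B, ℂ)) :
    ∫ χ, f χ ∂μ = ⟪x, continuousCalculus ρ f x⟫_ℂ := by
  have hcont : Continuous fun f : C(UnitizedSpectrum B, ℂ) =>
      ⟪toLp μ 1, toLp μ (ofContinuous _ f)⟫_ℂ :=
    continuous_const.inner (ContinuousMap.toLp 2 μ ℂ).continuous
  have hB : ∀ b, ⟪toLp μ 1, toLp μ (ofContinuous _ (gelfandInr B b))⟫_ℂ = ⟪x, ρ b x⟫_ℂ :=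
    congrFun <| hι.equalizer (hcont.comp continuous_gelfandInr)
      (continuous_const.inner ((map_continuous ρ).clm_apply continuous_const)) <|
      funext fun a => (integral_ofContinuous_eq_inner μ _).symm.trans (hA a)
  have h1 : ⟪toLp μ 1, toLp μ 1⟫_ℂ = ⟪x, x⟫_ℂ := by
    rw [inner_toLp, ← hμ]
    simp
  rw [integral_ofContinuous_eq_inner]
  obtain ⟨r, b, rfl⟩ := exists_eq_algebraMap_add_gelfandInr f
  simp only [map_add, Algebra.algebraMap_eq_smul_one, map_smul, map_one,
    continuousCalculus_gelfandInr, inner_add_right, inner_smul_right, add_apply, smul_apply,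
    one_apply_eq_self, hB, h1]

theorem integral_unitalExtension_eq_inner {Q : SpectralMeasure (spectrumVia ι) H}
    (hQ : ∀ a, Q.HasNormIntegral (fun σ => (σ : A →ₙₐ[ℂ] ℂ) a) (ρ (ι a)))
    (f : C(UnitizedSpectrum B, ℂ)) (x : H) :
    ∫ σ, f (unitalExtension hι σ) ∂Q.measure x = ⟪x, continuousCalculus ρ f x⟫_ℂ := by
  have he := (isOpenEmbedding_unitalExtension hι).measurableEmbedding
  rw [← he.integral_map]
  refine integral_eq_inner_continuousCalculus hι ?_ (fun a => ?_) f
  · have huniv := Q.inner_toFun ⟨Set.univ, .univ⟩ x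
    rw [Q.map_univ', one_apply_eq_self] at huniv
    rw [huniv, map_measureReal_apply he.measurable .univ, Set.preimage_univ]
  · rw [he.integral_map, (hQ a).inner_eq_integral]
    simp only [restrict_unitalExtension]

variable (hρ : ∀ x, (∀ b, ρ b x = 0) → x = 0)

/-- The spectral measure on `spectrumVia ι` of a non-degenerate representation of `B`. -/
noncomputable def spectralMeasureVia : SpectralMeasure (spectrumVia ι) H :=
  spectralMeasureOn (isOpenEmbedding_unitalExtension hι).measurableEmbedding
    (borelCalculus_indicator_range_unitalExtension hι hρ)

theorem isResolutionOfIdentity_spectralMeasureVia [Nontrivial H] :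
    (spectralMeasureVia hι hρ).IsResolutionOfIdentity :=
  isResolutionOfIdentity_spectralMeasureOn (isOpenEmbedding_unitalExtension hι) _

theorem hasNormIntegral_spectralMeasureVia (a : A) :
    (spectralMeasureVia hι hρ).HasNormIntegral (fun σ => (σ : A →ₙₐ[ℂ] ℂ) a) (ρ (ι a)) := by
  have hval : gelfandInr B (ι a) ∘ unitalExtension hι =
      fun σ : spectrumVia ι => (σ : A →ₙₐ[ℂ] ℂ) a :=
    funext fun σ => restrict_unitalExtension hι σ a
  rw [← hval, ← continuousCalculus_gelfandInr]
  exact hasNormIntegral_spectralMeasureOn _ _ _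

theorem eq_spectralMeasureVia {Q : SpectralMeasure (spectrumVia ι) H}
    (hQ : ∀ x, (Q.measure x).InnerRegular)
    (hQA : ∀ a, Q.HasNormIntegral (fun σ => (σ : A →ₙₐ[ℂ] ℂ) a) (ρ (ι a))) :
    Q = spectralMeasureVia hι hρ :=
  eq_spectralMeasureOn (isOpenEmbedding_unitalExtension hι) _ hQ
    (integral_unitalExtension_eq_inner hι hQA)

theorem centralizer_range_spectralMeasureVia :
    Set.centralizer (Set.range (spectralMeasureVia hι hρ).toFun) =
      Set.centralizer (Set.range fun a => ρ (ι a)) :=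
  (centralizer_range_spectralMeasureOn _ _).trans (centralizer_range_continuousCalculus hι)

theorem isSupport_spectralMeasureVia (hinj : Function.Injective ρ) :
    (spectralMeasureVia hι hρ).IsSupport Set.univ :=
  isSupport_spectralMeasureOn (isOpenEmbedding_unitalExtension hι) _ fun _ hf =>
    eq_zero_of_continuousCalculus_eq_zero hinj <| hf _ <| by simp [range_unitalExtension]

end Representation

namespace StarRep

variable {A : Type*} {H : Type*} [NonUnitalCommRing A] [Module ℂ A] [StarRing A]
  [NormedAddCommGroup H] [InnerProductSpace ℂ H] [CompleteSpace H] (π : StarRep A H)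

theorem mul_comm_of_mem_closedRange {S T : H →L[ℂ] H} (hS : S ∈ π.closedRange)
    (hT : T ∈ π.closedRange) : S * T = T * S := by
  have hcomm : ∀ S T : NonUnitalStarAlgHom.range π.toStarHom, S * T = T * S := by
    rintro ⟨_, a, rfl⟩ ⟨_, b, rfl⟩
    refine Subtype.ext ?_
    change π.toStarHom a * π.toStarHom b = π.toStarHom b * π.toStarHom a
    rw [← map_mul, mul_comm, map_mul]
  exact congrArg Subtype.val ((NonUnitalStarSubalgebra.nonUnitalCommRingTopologicalClosure
    (NonUnitalStarAlgHom.range π.toStarHom) hcomm).mul_comm ⟨S, hS⟩ ⟨T, hT⟩)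

noncomputable instance : NonUnitalCommCStarAlgebra π.closedRange :=
  { NonUnitalStarSubalgebra.nonUnitalCStarAlgebra π.closedRange (h_closed := isClosed_closure) with
    mul_comm := fun S T => Subtype.ext (π.mul_comm_of_mem_closedRange S.2 T.2) }

theorem denseRange_toClosedRange : DenseRange π.toClosedRange := by
  intro T
  rw [closure_subtype, ← Set.range_comp]
  exact T.2

theorem toClosedRange_star (a : A) : π.toClosedRange (star a) = star (π.toClosedRange a) :=
  Subtype.ext (map_star π.toStarHom a)

end StarRep

theorem mainTheorem6 {A : Type*} {H : Type*}
    [NonUnitalCommRing A] [Module ℂ A] [IsScalarTower ℂ A A] [SMulCommClass ℂ A A]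
    [StarRing A] [StarModule ℂ A]
    [NormedAddCommGroup H] [InnerProductSpace ℂ H] [CompleteSpace H] [Nontrivial H]
    (π : StarRep A H) (hπ : π.NonDegenerate) :
    π.sp ⊆ hermitianMultFunctionals A ∧
    ∃ P : SpectralMeasure π.sp H,
      (P.IsResolutionOfIdentity ∧
        ∀ a : A, P.HasNormIntegral (fun σ : π.sp => (σ : A →ₙₐ[ℂ] ℂ) a) (π.toStarHom a)) ∧
      (∀ Q : SpectralMeasure π.sp H, Q.IsResolutionOfIdentity →
        (∀ a : A, Q.HasNormIntegral (fun σ : π.sp => (σ : A →ₙₐ[ℂ] ℂ) a) (π.toStarHom a)) →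
        Q = P) ∧
      Set.centralizer (Set.range π.toStarHom) = Set.centralizer (Set.range P.toFun) ∧
      P.IsSupport Set.univ := by
  have hdense := π.denseRange_toClosedRange
  let ρ := NonUnitalStarSubalgebraClass.subtype π.closedRange
  have hρ : ∀ x, (∀ T, ρ T x = 0) → x = 0 := fun x hx => hπ x fun a => hx (π.toClosedRange a)
  refine ⟨spectrumVia_subset_hermitianMultFunctionals hdense π.toClosedRange_star,
    spectralMeasureVia hdense hρ, ⟨?_, ?_⟩, ?_, ?_, ?_⟩
  · exact isResolutionOfIdentity_spectralMeasureVia hdense hρ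
  · exact hasNormIntegral_spectralMeasureVia hdense hρ
  · exact fun Q hQ hQA => eq_spectralMeasureVia hdense hρ hQ.2.2.2 hQA
  · exact (centralizer_range_spectralMeasureVia hdense hρ).symm
  · exact isSupport_spectralMeasureVia hdense hρ Subtype.val_injective
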